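/- Conventions. A permutation of order $n$ is a bijection of $[n]=\{1,\dots,n\}$. For permutations $\sigma$ of order $m$ and $\pi$ of order $n\ge m$, the density $d(\sigma,\pi)$ is the probability that a uniformly random $m$-element subset $\{i_1<\dots<i_m\}$ of $[n]$ satisfies $\sigma(j)<\sigma(j')\iff\pi(i_j)<\pi(i_{j'})$ for all $j,j'\in[m]$. A sequence $(\pi_n)_{n\in\mathbb N}$ of permutations is convergent if the orders of the $\pi_n$ tend to infinity and $d(\sigma,\pi_n)$ converges for every permutation $\sigma$. A permutation $\sigma$ of order $m$ is layered if $[m]$ can be partitioned into nonempty intervals $I_1,\dots,I_k$ (listed from left to right) such that $\sigma$ is decreasing on each $I_j$ and $\sigma(x)<\sigma(x')$ whenever $x\in I_j$, $x'\in I_{j'}$ and $j<j'$. This partition is unique; its parts are the layers of $\sigma$. A permuton is a Borel probability measure $\Pi$ on $[0,1]^2$ with $\Pi([a,b]\times[0,1])=\Pi([0,1]\times[a,b])=b-a$ for all $0\le a\le b\le 1$. The density $d(\sigma,\Pi)$ of a permutation $\sigma$ of order $m$ in $\Pi$ is the probability that $m$ independent $\Pi$-random points, sorted as $(x_1,y_1),\dots,(x_m,y_m)$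 with $x_1<\dots<x_m$, satisfy $\sigma(i)<\sigma(j)\iff y_i<y_j$ for all $i,j\in[m]$. A permuton $\Pi$ is a limit of a convergent sequence $(\pi_n)$ if $d(\sigma,\Pi)=\lim_{n\to\infty}d(\sigma,\pi_n)$ for every permutation $\sigma$. A permuton $\Pi$ is layered if there is a collection $\mathcal J$ of closed subintervals $[a,b]$, $a\le b$, of $[0,1]$ (intervals $[a,a]$ are allowed) such that any two distinct members $[a,b],[a',b']$ satisfy $b\le a'$ or $b'\le a$, and the support of $\Pi$ is exactly the set of points $(x,\,b-(x-a))$ with $[a,b]\in\mathcal J$ and $x\in[a,b]$. The collection $\mathcal J$ is unique if it exists; its members are the layers of $\Pi$, and the number of layers of $\Pi$ is the (possibly infinite) cardinality of $\mathcal J$. Lemma. Let $(\pi_n)_{n\in\mathbb N}$ be a convergent sequence of permutations and let the permuton $\Pi$ be its limit. If $\pi_n$ is layered for every $n\in\mathbb N$, then $\Pi$ is layered. Moreover, if in addition there is $k\in\mathbb N$ such that every $\pi_n$ has at most $k$ layers, then $\Pi$ has at most $k$ layers. -/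

import Mathlib

open Filter Topology MeasureTheory

/-! ### Permutations

A permutation of order `n` is an element of `Equiv.Perm (Fin n)`. -/

namespace LayeredPerm

/-- The points `f 0 < ⋯ < f (m - 1)` induce the permutation `σ` in the permutation `π`. -/
def Induces {m n : ℕ} (σ : Equiv.Perm (Fin m)) (π : Equiv.Perm (Fin n))
    (f : Fin m ↪o Fin n) : Prop :=
  ∀ j j' : Fin m, σ j < σ j' ↔ π (f j) < π (f j')

/-- The density `d(σ, π)`: the probability that `m` distinct points of `Fin n`, chosen uniformly
at random, induce `σ`. The `m`-element subsets of `Fin n` are identified with their increasing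
enumerations. (Only meaningful for `m ≤ n`; the value is `0` otherwise.) -/
noncomputable def density {m n : ℕ} (σ : Equiv.Perm (Fin m)) (π : Equiv.Perm (Fin n)) : ℝ :=
  (Nat.card {f : Fin m ↪o Fin n // Induces σ π f} : ℝ) / (n.choose m : ℝ)

/-- The partition `P` of `Fin n` into nonempty sets witnesses that `σ` is layered: its parts are
intervals, `σ` is decreasing on each part, and the values of `σ` on an earlier part are smaller
than those on a later part. -/
structure IsLayering {n : ℕ} (σ : Equiv.Perm (Fin n))
    (P : Finpartition (Finset.univ : Finset (Fin n))) : Prop where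
  ordConnected : ∀ A ∈ P.parts, (A : Set (Fin n)).OrdConnected
  anti : ∀ A ∈ P.parts, StrictAntiOn σ (A : Set (Fin n))
  lt : ∀ A ∈ P.parts, ∀ B ∈ P.parts, A ≠ B → ∀ x ∈ A, ∀ x' ∈ B, x < x' → σ x < σ x'

/-- A permutation is layered if its domain can be partitioned into layers. -/
def IsLayered {n : ℕ} (σ : Equiv.Perm (Fin n)) : Prop :=
  ∃ P : Finpartition (Finset.univ : Finset (Fin n)), IsLayering σ P

/-- The layers of a permutation (the parts of its layering, which is unique if it exists). -/
def layers {n : ℕ} (σ : Equiv.Perm (Fin n)) : Set (Finset (Fin n)) :=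
  {A | ∃ P : Finpartition (Finset.univ : Finset (Fin n)), IsLayering σ P ∧ A ∈ P.parts}

/-- The number of layers of a layered permutation. -/
noncomputable def numLayers {n : ℕ} (σ : Equiv.Perm (Fin n)) : ℕ := (layers σ).ncard

theorem IsLayering.mem_iff {n : ℕ} {σ : Equiv.Perm (Fin n)}
    {P : Finpartition (Finset.univ : Finset (Fin n))} (h : IsLayering σ P)
    {A : Finset (Fin n)} (hA : A ∈ P.parts) {x : Fin n} (hx : x ∈ A) (y : Fin n) :
    y ∈ A ↔ (x < y ↔ σ y < σ x) := by
  constructor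
  · intro hy
    exact (StrictAntiOn.lt_iff_gt (h.anti A hA) hy hx).symm
  · intro hiff
    by_contra hy
    obtain ⟨B, hB, hyB⟩ := P.exists_mem (Finset.mem_univ y)
    have hne : A ≠ B := fun e => hy (e ▸ hyB)
    rcases lt_trichotomy x y with hlt | heq | hgt
    · exact lt_asymm (h.lt A hA B hB hne x hx y hyB hlt) (hiff.1 hlt)
    · exact hy (heq ▸ hx)
    · exact lt_asymm hgt (hiff.2 (h.lt B hB A hA hne.symm y hyB x hx hgt))

/-- The layers of a layered permutation are uniquely determined. -/
theorem IsLayering.layers_eq {n : ℕ} {σ : Equiv.Perm (Fin n)}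
    {P : Finpartition (Finset.univ : Finset (Fin n))} (h : IsLayering σ P) :
    layers σ = (P.parts : Set (Finset (Fin n))) := by
  ext A
  refine ⟨?_, fun hA => ⟨P, h, hA⟩⟩
  rintro ⟨Q, hQ, hA⟩
  obtain ⟨x, hx⟩ := Q.nonempty_of_mem_parts hA
  obtain ⟨B, hB, hxB⟩ := P.exists_mem (Finset.mem_univ x)
  have : A = B := by
    ext y
    rw [hQ.mem_iff hA hx, h.mem_iff hB hxB]
  exact this ▸ hB

end LayeredPerm

/-! ### Permutons -/

/-- A permuton: a Borel probability measure on `[0,1]²` with uniform marginals. -/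
structure Permuton where
  measure : Measure (unitInterval × unitInterval)
  isProbabilityMeasure : IsProbabilityMeasure measure
  measure_fst : ∀ a b : unitInterval, a ≤ b →
    measure (Set.Icc a b ×ˢ Set.univ) = ENNReal.ofReal ((b : ℝ) - a)
  measure_snd : ∀ a b : unitInterval, a ≤ b →
    measure (Set.univ ×ˢ Set.Icc a b) = ENNReal.ofReal ((b : ℝ) - a)

namespace Permuton

/-- The points `p 0, …, p (m - 1)` of the unit square, listed in any order, yield the permutation
`σ`: after sorting (by `τ`) they have increasing `x`-coordinates, and `σ i < σ j` if and only if
the `i`-th of the sorted points has a smaller `y`-coordinate than the `j`-th. -/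
def Yields {m : ℕ} (p : Fin m → unitInterval × unitInterval) (σ : Equiv.Perm (Fin m)) : Prop :=
  ∃ τ : Equiv.Perm (Fin m), StrictMono (fun i => (p (τ i)).1) ∧
    ∀ i j : Fin m, σ i < σ j ↔ (p (τ i)).2 < (p (τ j)).2

/-- The density `d(σ, Π)`: the probability that `m` independent `Π`-random points yield `σ`. -/
noncomputable def density {m : ℕ} (σ : Equiv.Perm (Fin m)) (P : Permuton) : ℝ :=
  (Measure.pi (fun _ : Fin m => P.measure)).real {p | Yields p σ}

/-- The collection `J` of closed intervals `[A.fst, A.snd]` witnesses that `P` is layered. The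
intervals are internally disjoint, i.e. no inner point of one of them lies in another one (this
concerns intervals of length zero, too), and the support of `P` is the union of the antidiagonals
of the squares `[A.fst, A.snd]²`. -/
structure IsLayering (P : Permuton) (J : Set (NonemptyInterval unitInterval)) : Prop where
  internally_disjoint : ∀ A ∈ J, ∀ B ∈ J, A ≠ B → A.snd ≤ B.fst ∨ B.snd ≤ A.fst
  mem_support : ∀ x y : unitInterval, (x, y) ∈ P.measure.support ↔
    ∃ A ∈ J, x ∈ Set.Icc A.fst A.snd ∧ (y : ℝ) = (A.snd : ℝ) - ((x : ℝ) - (A.fst : ℝ))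

/-- A permuton is layered if there is a collection of intervals as above. -/
def IsLayered (P : Permuton) : Prop :=
  ∃ J : Set (NonemptyInterval unitInterval), IsLayering P J

/-- The layers of a permuton (the members of its layering, which is unique if it exists). -/
def layers (P : Permuton) : Set (NonemptyInterval unitInterval) :=
  {A | ∃ J : Set (NonemptyInterval unitInterval), IsLayering P J ∧ A ∈ J}

/-- The number of layers of a layered permuton, a possibly infinite cardinal. -/
noncomputable def numLayers (P : Permuton) : Cardinal := Cardinal.mk P.layers

theorem IsLayering.subset {P : Permuton} {J K : Set (NonemptyInterval unitInterval)}
    (hJ : IsLayering P J) (hK : IsLayering P K) : J ⊆ K := by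
  -- two members of one layering with the same midpoint coincide
  have mid : ∀ {L : Set (NonemptyInterval unitInterval)}, IsLayering P L → ∀ A ∈ L, ∀ B ∈ L,
      (A.fst : ℝ) + A.snd = B.fst + B.snd → A = B := by
    intro L hL A hA B hB hAB
    by_contra hne
    have h1 : (A.fst : ℝ) ≤ A.snd := A.fst_le_snd
    have h2 : (B.fst : ℝ) ≤ B.snd := B.fst_le_snd
    have h3 : (A.snd : ℝ) ≤ B.fst ∨ (B.snd : ℝ) ≤ A.fst := hL.internally_disjoint A hA B hB hne
    apply hne
    ext
    · rcases h3 with h | h <;> linarith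
    · rcases h3 with h | h <;> linarith
  -- a member of one layering is contained in a member of the other with the same midpoint
  have cov : ∀ {L M : Set (NonemptyInterval unitInterval)}, IsLayering P L → IsLayering P M →
      ∀ A ∈ L, ∃ B ∈ M, (A.fst : ℝ) + A.snd = B.fst + B.snd ∧ (B.fst : ℝ) ≤ A.fst := by
    intro L M hL hM A hA
    have hmem : (A.fst, A.snd) ∈ P.measure.support :=
      (hL.mem_support _ _).2 ⟨A, hA, ⟨le_rfl, A.fst_le_snd⟩, by ring⟩
    obtain ⟨B, hB, hx, hy⟩ := (hM.mem_support _ _).1 hmem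
    exact ⟨B, hB, by linarith, hx.1⟩
  intro A hA
  obtain ⟨B, hB, hAB, hle⟩ := cov hJ hK A hA
  obtain ⟨C, hC, hBC, hle'⟩ := cov hK hJ B hB
  have hAC : A = C := mid hJ A hA C hC (hAB.trans hBC)
  subst hAC
  have : A = B := by
    ext <;> linarith
  exact this ▸ hB

/-- The collection of layers of a layered permuton is uniquely determined. -/
theorem IsLayering.layers_eq {P : Permuton} {J : Set (NonemptyInterval unitInterval)}
    (h : IsLayering P J) : P.layers = J := by
  ext A
  refine ⟨?_, fun hA => ⟨J, h, hA⟩⟩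
  rintro ⟨K, hK, hA⟩
  exact hK.subset h hA

end Permuton

/-! ### Convergence -/

/-- A sequence of permutations `π n` of order `N n` is convergent if the orders tend to infinity
and the density of every permutation converges. -/
def PermConvergent (N : ℕ → ℕ) (π : ∀ n : ℕ, Equiv.Perm (Fin (N n))) : Prop :=
  Tendsto N atTop atTop ∧
    ∀ (m : ℕ) (σ : Equiv.Perm (Fin m)),
      ∃ d : ℝ, Tendsto (fun n => LayeredPerm.density σ (π n)) atTop (𝓝 d)

/-- The permuton `P` is a limit of the sequence of permutations `π n`. -/
def Permuton.IsLimit (P : Permuton) (N : ℕ → ℕ) (π : ∀ n : ℕ, Equiv.Perm (Fin (N n))) : Prop :=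
  ∀ (m : ℕ) (σ : Equiv.Perm (Fin m)),
    Tendsto (fun n => LayeredPerm.density σ (π n)) atTop (𝓝 (Permuton.density σ P))

/-! A layered permutation contains neither 231 (`finRotate 3`) nor 312 (its inverse), so both
patterns have density zero in the limit. Any pattern formed by points of the support has positive
density (`density_pos`), so no three support points form 231 or 312. For a point p, let a be the
mass strictly below and to the left of p, and 1 - b the mass strictly above and to the right.
Uniform marginals give a + b = x + y (`lower_add_upper`), so p lies on the antidiagonal of [a, b]².
Pattern avoidance makes a and b cuts (`isCut_lower`, `isCut_upper`), and no cut falls strictly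
inside [a, b], so two such intervals coincide or are internally disjoint (`layer_eq_or_disjoint`).
Every vertical line meets the support and the support is closed, so each antidiagonal is filled
completely. For the count, k + 1 layers would yield an increasing pattern of order k + 1 in the
support, but a layered permutation with at most k layers contains none. -/

/-! ### Points of the support of a measure -/

section Support

variable {Ω : Type*} [TopologicalSpace Ω] [MeasurableSpace Ω] {μ : Measure Ω}

/-- Comparing measures of sets only requires an inclusion on the support. -/
theorem measureReal_le_of_support [HereditarilyLindelofSpace Ω] [IsFiniteMeasure μ] {A B : Set Ω}
    (h : ∀ q ∈ μ.support, q ∈ A → q ∈ B) : μ.real A ≤ μ.real B := by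
  refine ENNReal.toReal_mono (measure_ne_top _ _) (measure_mono_ae ?_)
  filter_upwards [Measure.support_mem_ae (μ := μ)] with q hq hA using h q hq hA

/-- Near a point of the support there are points of the support outside a given null set. -/
theorem exists_mem_support_notMem [HereditarilyLindelofSpace Ω] {q : Ω} (hq : q ∈ μ.support)
    {U : Set Ω} (hU : U ∈ 𝓝 q) {Z : Set Ω} (hZ : μ Z = 0) :
    ∃ q' ∈ μ.support, q' ∈ U ∧ q' ∉ Z := by
  have hpos : 0 < μ U := (Measure.mem_support_iff_forall q).1 hq U hU
  have hpos' : 0 < μ (U \ Z) := by rwa [measure_sdiff_null hZ]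
  obtain ⟨q', h1, h2⟩ := Measure.nonempty_inter_support_of_pos hpos'
  exact ⟨q', h2, h1.1, h1.2⟩

end Support

/-! ### Ends of layers for measures avoiding 231 and 312 -/

namespace UniformAvoiding

variable {Ω : Type*} [MeasurableSpace Ω] {μ : Measure Ω} {f g : Ω → ℝ}

/-- The lower end of the layer of `p`. -/
noncomputable def lower (μ : Measure Ω) (f g : Ω → ℝ) (p : Ω) : ℝ :=
  μ.real {q | f q < f p ∧ g q < g p}

/-- The upper end of the layer of `p`. -/
noncomputable def upper (μ : Measure Ω) (f g : Ω → ℝ) (p : Ω) : ℝ :=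
  1 - μ.real {q | f p < f q ∧ g p < g q}

theorem lower_swap (p : Ω) : lower μ g f p = lower μ f g p := by
  simp only [lower, and_comm]

/-- Rotation by a half turn exchanges the two ends of a layer, so facts about `upper` follow from
facts about `lower`. -/
theorem lower_compl (p : Ω) :
    lower μ (fun q => 1 - f q) (fun q => 1 - g q) p = 1 - upper μ f g p := by
  simp [lower, upper]

theorem lower_nonneg (p : Ω) : 0 ≤ lower μ f g p := measureReal_nonneg

theorem upper_le_one (p : Ω) : upper μ f g p ≤ 1 := by
  have : 0 ≤ μ.real {q | f p < f q ∧ g p < g q} := measureReal_nonneg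
  unfold upper
  linarith

variable [IsProbabilityMeasure μ]

theorem lower_le_one (p : Ω) : lower μ f g p ≤ 1 := measureReal_le_one

theorem upper_nonneg (p : Ω) : 0 ≤ upper μ f g p := by
  have : μ.real {q | f p < f q ∧ g p < g q} ≤ 1 := measureReal_le_one
  unfold upper
  linarith

end UniformAvoiding

/-- Two coordinates `f` and `g` with values in `[0, 1]`, uniformly distributed with respect to `μ`,
such that no three points of the support of `μ` form the pattern `231` or `312`. -/
structure UniformAvoiding {Ω : Type*} [TopologicalSpace Ω] [MeasurableSpace Ω] (μ : Measure Ω)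
    (f g : Ω → ℝ) : Prop where
  cont_fst : Continuous f
  cont_snd : Continuous g
  mem_fst : ∀ q, f q ∈ Set.Icc (0 : ℝ) 1
  mem_snd : ∀ q, g q ∈ Set.Icc (0 : ℝ) 1
  real_fst_lt : ∀ c ∈ Set.Icc (0 : ℝ) 1, μ.real {q | f q < c} = c
  real_fst_le : ∀ c ∈ Set.Icc (0 : ℝ) 1, μ.real {q | f q ≤ c} = c
  real_snd_lt : ∀ c ∈ Set.Icc (0 : ℝ) 1, μ.real {q | g q < c} = c
  real_snd_le : ∀ c ∈ Set.Icc (0 : ℝ) 1, μ.real {q | g q ≤ c} = c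
  not_231 : ∀ p ∈ μ.support, ∀ q ∈ μ.support, ∀ r ∈ μ.support,
    f p < f q → f q < f r → g p < g q → ¬ g r < g p
  not_312 : ∀ p ∈ μ.support, ∀ q ∈ μ.support, ∀ r ∈ μ.support,
    f p < f q → f q < f r → g q < g r → ¬ g r < g p

/-! ### Symmetries, cuts and disjointness of layers -/

namespace UniformAvoiding

variable {Ω : Type*} [TopologicalSpace Ω] [MeasurableSpace Ω]

/-- The support of `μ` is contained in the union of two squares `[0, c]²` and `[c, 1]²`. -/
def IsCut (μ : Measure Ω) (f g : Ω → ℝ) (c : ℝ) : Prop :=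
  ∀ q ∈ μ.support, (f q ≤ c ∧ g q ≤ c) ∨ (c ≤ f q ∧ c ≤ g q)

variable {μ : Measure Ω} {f g : Ω → ℝ}

/-- Reflection in the diagonal inverts patterns, and 231 and 312 are inverse to each other. -/
theorem swap (h : UniformAvoiding μ f g) : UniformAvoiding μ g f where
  cont_fst := h.cont_snd
  cont_snd := h.cont_fst
  mem_fst := h.mem_snd
  mem_snd := h.mem_fst
  real_fst_lt := h.real_snd_lt
  real_fst_le := h.real_snd_le
  real_snd_lt := h.real_fst_lt
  real_snd_le := h.real_fst_le
  not_231 p hp q hq r hr h1 h2 h3 h4 := h.not_312 r hr p hp q hq h4 h3 h1 h2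
  not_312 p hp q hq r hr h1 h2 h3 h4 := h.not_231 q hq r hr p hp h3 h4 h2 h1

theorem IsCut.compl {c : ℝ} (hcut : IsCut μ f g c) :
    IsCut μ (fun q => 1 - f q) (fun q => 1 - g q) (1 - c) := by
  intro q hq
  simpa only [sub_le_sub_iff_left] using (hcut q hq).symm

variable [IsProbabilityMeasure μ]

theorem lower_le_fst (h : UniformAvoiding μ f g) (p : Ω) : lower μ f g p ≤ f p := by
  rw [← h.real_fst_lt _ (h.mem_fst p)]
  exact measureReal_mono fun q hq => hq.1

theorem lower_le_snd (h : UniformAvoiding μ f g) (p : Ω) : lower μ f g p ≤ g p := by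
  rw [← lower_swap]
  exact h.swap.lower_le_fst p

variable [OpensMeasurableSpace Ω]

theorem real_one_sub_lt (hf : Continuous f)
    (h : ∀ c ∈ Set.Icc (0 : ℝ) 1, μ.real {q | f q ≤ c} = c) {c : ℝ} (hc : c ∈ Set.Icc (0 : ℝ) 1) :
    μ.real {q | 1 - f q < c} = c := by
  have hset : {q | 1 - f q < c} = {q | f q ≤ 1 - c}ᶜ := by
    ext q
    simp only [Set.mem_ofPred_eq, Set.mem_compl_iff, not_le]
    constructor <;> intro <;> linarith
  rw [hset, probReal_compl_eq_one_sub (isClosed_le hf continuous_const).measurableSet,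
    h _ ⟨by linarith [hc.2], by linarith [hc.1]⟩]
  ring

theorem real_one_sub_le (hf : Continuous f)
    (h : ∀ c ∈ Set.Icc (0 : ℝ) 1, μ.real {q | f q < c} = c) {c : ℝ} (hc : c ∈ Set.Icc (0 : ℝ) 1) :
    μ.real {q | 1 - f q ≤ c} = c := by
  have hset : {q | 1 - f q ≤ c} = {q | f q < 1 - c}ᶜ := by
    ext q
    simp only [Set.mem_ofPred_eq, Set.mem_compl_iff, not_lt]
    constructor <;> intro <;> linarith
  rw [hset, probReal_compl_eq_one_sub (isOpen_lt hf continuous_const).measurableSet,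
    h _ ⟨by linarith [hc.2], by linarith [hc.1]⟩]
  ring

/-- The half turn also exchanges 231 and 312. It swaps strict and weak inequalities as well, which
is why the structure records both. -/
theorem compl (h : UniformAvoiding μ f g) :
    UniformAvoiding μ (fun q => 1 - f q) (fun q => 1 - g q) where
  cont_fst := continuous_const.sub h.cont_fst
  cont_snd := continuous_const.sub h.cont_snd
  mem_fst q := ⟨by linarith [(h.mem_fst q).2], by linarith [(h.mem_fst q).1]⟩
  mem_snd q := ⟨by linarith [(h.mem_snd q).2], by linarith [(h.mem_snd q).1]⟩
  real_fst_lt _ hc := real_one_sub_lt h.cont_fst h.real_fst_le hc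
  real_fst_le _ hc := real_one_sub_le h.cont_fst h.real_fst_lt hc
  real_snd_lt _ hc := real_one_sub_lt h.cont_snd h.real_snd_le hc
  real_snd_le _ hc := real_one_sub_le h.cont_snd h.real_snd_lt hc
  not_231 p hp q hq r hr h1 h2 h3 h4 :=
    h.not_312 r hr q hq p hp (by linarith) (by linarith) (by linarith) (by linarith)
  not_312 p hp q hq r hr h1 h2 h3 h4 :=
    h.not_231 r hr q hq p hp (by linarith) (by linarith) (by linarith) (by linarith)

theorem real_fst_eq (h : UniformAvoiding μ f g) {c : ℝ} (hc : c ∈ Set.Icc (0 : ℝ) 1) :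
    μ.real {q | f q = c} = 0 := by
  have hset : {q | f q = c} = {q | f q ≤ c} \ {q | f q < c} := by
    ext q
    simp only [Set.mem_ofPred_eq, Set.mem_sdiff, not_lt]
    exact le_antisymm_iff
  have hsub : {q | f q < c} ⊆ {q | f q ≤ c} := fun q (hq : f q < c) => hq.le
  rw [hset, measureReal_sdiff hsub (isOpen_lt h.cont_fst continuous_const).measurableSet, h.real_fst_le c hc, h.real_fst_lt c hc,
    sub_self]

theorem real_snd_eq (h : UniformAvoiding μ f g) {c : ℝ} (hc : c ∈ Set.Icc (0 : ℝ) 1) :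
    μ.real {q | g q = c} = 0 :=
  h.swap.real_fst_eq hc

theorem fst_le_upper (h : UniformAvoiding μ f g) (p : Ω) : f p ≤ upper μ f g p := by
  have := h.compl.lower_le_fst p
  rw [lower_compl] at this
  linarith

/-- Inclusion-exclusion for the half-planes to the left of `p` and below `p`. Their intersection
differs from the open quadrant by two null lines. -/
theorem lower_add_upper (h : UniformAvoiding μ f g) (p : Ω) :
    lower μ f g p + upper μ f g p = f p + g p := by
  have hx := h.mem_fst p
  have hy := h.mem_snd p
  have hF : MeasurableSet {q | f q ≤ f p} :=
    (isClosed_le h.cont_fst continuous_const).measurableSet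
  have hG : MeasurableSet {q | g q ≤ g p} :=
    (isClosed_le h.cont_snd continuous_const).measurableSet
  have hunion : μ.real ({q | f q ≤ f p} ∪ {q | g q ≤ g p}) = upper μ f g p := by
    have : {q | f p < f q ∧ g p < g q} = ({q | f q ≤ f p} ∪ {q | g q ≤ g p})ᶜ := by
      ext q
      simp
    rw [upper, this, probReal_compl_eq_one_sub (hF.union hG)]
    ring
  have hinter : μ.real ({q | f q ≤ f p} ∩ {q | g q ≤ g p}) = lower μ f g p := by
    apply le_antisymm
    · have hsub : {q | f q ≤ f p} ∩ {q | g q ≤ g p} ⊆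
          {q | f q < f p ∧ g q < g p} ∪ ({q | f q = f p} ∪ {q | g q = g p}) := by
        rintro q ⟨h1 : f q ≤ f p, h2 : g q ≤ g p⟩
        rcases eq_or_lt_of_le h1 with h1 | h1
        · exact Or.inr (Or.inl h1)
        rcases eq_or_lt_of_le h2 with h2 | h2
        · exact Or.inr (Or.inr h2)
        exact Or.inl ⟨h1, h2⟩
      have h1 := measureReal_mono (μ := μ) hsub
      have h2 := measureReal_union_le (μ := μ) {q | f q < f p ∧ g q < g p}
        ({q | f q = f p} ∪ {q | g q = g p})
      have h3 := measureReal_union_le (μ := μ) {q | f q = f p} {q | g q = g p}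
      rw [h.real_fst_eq hx, h.real_snd_eq hy] at h3
      unfold lower
      linarith
    · exact measureReal_mono fun q hq => ⟨hq.1.le, hq.2.le⟩
  have := measureReal_union_add_inter (μ := μ) (s := {q | f q ≤ f p}) hG
  rw [hunion, hinter, h.real_fst_le _ hx, h.real_snd_le _ hy] at this
  linarith

variable [HereditarilyLindelofSpace Ω]

/-- This is where the forbidden patterns enter. A violating `q` can be moved within the support to a
violating `s` off the horizontal line through `p`; each position of `s` contradicts one pattern. -/
theorem snd_le_lower (h : UniformAvoiding μ f g) {p q : Ω} (hp : p ∈ μ.support)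
    (hq : q ∈ μ.support) (hlt : f q < lower μ f g p) : g q ≤ lower μ f g p := by
  by_contra! hgt
  have hU : {q | f q < lower μ f g p ∧ lower μ f g p < g q} ∈ 𝓝 q :=
    ((isOpen_lt h.cont_fst continuous_const).inter
      (isOpen_lt continuous_const h.cont_snd)).mem_nhds ⟨hlt, hgt⟩
  have hZ : μ {q | g q = g p} = 0 := by
    rw [← measureReal_eq_zero_iff]
    exact h.real_snd_eq (h.mem_snd p)
  obtain ⟨s, hs, ⟨hs1, hs2⟩, hs3⟩ := exists_mem_support_notMem hq hU hZ
  have hsp : f s < f p := hs1.trans_le (h.lower_le_fst p)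
  rcases lt_or_gt_of_ne hs3 with hs3 | hs3
  -- A point below `s` and to the right of `p` would complete the pattern 231 as `s`, `p`, `r`;
  -- hence `g s ≤ lower μ f g p`.
  · have h1 : μ.real {r | g r < g s} ≤ μ.real ({r | f r < f p ∧ g r < g p} ∪ {r | f r = f p}) := by
      refine measureReal_le_of_support fun r hr hrs => ?_
      rcases lt_trichotomy (f r) (f p) with hrp | hrp | hrp
      · exact Or.inl ⟨hrp, lt_trans hrs hs3⟩
      · exact Or.inr hrp
      · exact absurd hrs (h.not_231 s hs p hp r hr hsp hrp hs3)
    have h2 := measureReal_union_le (μ := μ) {r | f r < f p ∧ g r < g p} {r | f r = f p}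
    rw [h.real_fst_eq (h.mem_fst p)] at h2
    rw [h.real_snd_lt _ (h.mem_snd s)] at h1
    unfold lower at hs2
    linarith
  -- A point below and to the left of `p` but to the right of `s` would give 312 as `s`, `r`, `p`.
  · have h1 : lower μ f g p ≤ μ.real {r | f r ≤ f s} := by
      refine measureReal_le_of_support fun r hr hrp => ?_
      by_contra! hrs
      exact h.not_312 s hs r hr p hp (not_le.1 hrs) hrp.1 hrp.2 hs3
    rw [h.real_fst_le _ (h.mem_fst s)] at h1
    linarith

theorem isCut_lower (h : UniformAvoiding μ f g) {p : Ω} (hp : p ∈ μ.support) :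
    IsCut μ f g (lower μ f g p) := by
  intro q hq
  have h1 := h.snd_le_lower hp hq
  have h2 := h.swap.snd_le_lower hp hq
  rw [lower_swap] at h2
  rcases lt_or_ge (f q) (lower μ f g p) with h3 | h3
  · exact Or.inl ⟨h3.le, h1 h3⟩
  rcases lt_or_ge (g q) (lower μ f g p) with h4 | h4
  · exact Or.inl ⟨h2 h4, h4.le⟩
  exact Or.inr ⟨h3, h4⟩

theorem isCut_upper (h : UniformAvoiding μ f g) {p : Ω} (hp : p ∈ μ.support) :
    IsCut μ f g (upper μ f g p) := by
  intro q hq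
  have := h.compl.isCut_lower hp q hq
  rw [lower_compl] at this
  rcases this with ⟨h1, h2⟩ | ⟨h1, h2⟩
  · exact Or.inr ⟨by linarith, by linarith⟩
  · exact Or.inl ⟨by linarith, by linarith⟩

/-- A cut below and to the left of `p` is at most the lower end of the layer of `p`. -/
theorem IsCut.le_lower {c : ℝ} (hcut : IsCut μ f g c) (h : UniformAvoiding μ f g)
    (hc : c ∈ Set.Icc (0 : ℝ) 1) {p : Ω} (hf : c ≤ f p) (hg : c ≤ g p) : c ≤ lower μ f g p := by
  -- Up to the null line at height `c`, all support points to the left of the cut lie in the open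
  -- quadrant below `p`.
  have h1 : μ.real {r | f r < c} ≤ μ.real ({r | f r < f p ∧ g r < g p} ∪ {r | g r = c}) := by
    refine measureReal_le_of_support fun r hr (hrc : f r < c) => ?_
    rcases hcut r hr with h2 | h2
    · rcases eq_or_lt_of_le h2.2 with h3 | h3
      · exact Or.inr h3
      · exact Or.inl ⟨hrc.trans_le hf, h3.trans_le hg⟩
    · exact absurd h2.1 (not_le.2 hrc)
  have h2 := measureReal_union_le (μ := μ) {r | f r < f p ∧ g r < g p} {r | g r = c}
  rw [h.real_snd_eq hc] at h2
  rw [h.real_fst_lt _ hc] at h1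
  unfold lower
  linarith

/-- No cut lies strictly between the two ends of a layer. -/
theorem IsCut.le_lower_or_upper_le {c : ℝ} (hcut : IsCut μ f g c) (h : UniformAvoiding μ f g)
    (hc : c ∈ Set.Icc (0 : ℝ) 1) {p : Ω} (hp : p ∈ μ.support) :
    c ≤ lower μ f g p ∨ upper μ f g p ≤ c := by
  rcases hcut p hp with ⟨h1, h2⟩ | ⟨h1, h2⟩
  · right
    have := hcut.compl.le_lower h.compl (p := p) ⟨by linarith [hc.2], by linarith [hc.1]⟩
      (by linarith) (by linarith)
    rw [lower_compl] at this
    linarith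
  · exact Or.inl (hcut.le_lower h hc h1 h2)

/-- The layers of two points of the support are equal or internally disjoint. -/
theorem layer_eq_or_disjoint (h : UniformAvoiding μ f g) {p q : Ω} (hp : p ∈ μ.support)
    (hq : q ∈ μ.support) :
    (lower μ f g p = lower μ f g q ∧ upper μ f g p = upper μ f g q) ∨
      upper μ f g p ≤ lower μ f g q ∨ upper μ f g q ≤ lower μ f g p := by
  have key : ∀ {p q : Ω}, p ∈ μ.support → q ∈ μ.support →
      (lower μ f g p ≤ lower μ f g q ∨ upper μ f g q ≤ lower μ f g p) ∧
        (upper μ f g p ≤ lower μ f g q ∨ upper μ f g q ≤ upper μ f g p) := fun hp hq =>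
    ⟨(h.isCut_lower hp).le_lower_or_upper_le h ⟨lower_nonneg _, lower_le_one _⟩ hq,
      (h.isCut_upper hp).le_lower_or_upper_le h ⟨upper_nonneg _, upper_le_one _⟩ hq⟩
  obtain ⟨h1, h2⟩ := key hp hq
  obtain ⟨h3, h4⟩ := key hq hp
  by_contra! hcon
  obtain ⟨h5, h6, h7⟩ := hcon
  have h8 : lower μ f g p = lower μ f g q :=
    le_antisymm (h1.resolve_right h7.not_ge) (h3.resolve_right h6.not_ge)
  exact h5 h8 (le_antisymm (h4.resolve_left h7.not_ge) (h2.resolve_left h6.not_ge))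

end UniformAvoiding

/-! ### Patterns in layered permutations -/

namespace LayeredPerm

/-- In a layered permutation, the points between the two ends of an inversion belong to the same
layer. -/
theorem IsLayered.lt_and_lt {n : ℕ} {π : Equiv.Perm (Fin n)} (h : IsLayered π) {i j k : Fin n}
    (hij : i < j) (hjk : j < k) (hki : π k < π i) : π k < π j ∧ π j < π i := by
  obtain ⟨P, hP⟩ := h
  obtain ⟨A, hA, hiA⟩ := P.exists_mem (Finset.mem_univ i)
  obtain ⟨B, hB, hkB⟩ := P.exists_mem (Finset.mem_univ k)
  have hAB : A = B := by
    by_contra hne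
    exact lt_asymm hki (hP.lt A hA B hB hne i hiA k hkB (hij.trans hjk))
  subst hAB
  have hjA : j ∈ A := (hP.ordConnected A hA).out hiA hkB ⟨hij.le, hjk.le⟩
  exact ⟨hP.anti A hA hjA hkB hjk, hP.anti A hA hiA hjA hij⟩

/-- An increasing sequence in a layered permutation meets every layer at most once. -/
theorem IsLayered.le_numLayers {n m : ℕ} {π : Equiv.Perm (Fin n)} (h : IsLayered π)
    {f : Fin m ↪o Fin n} (hf : Induces (Equiv.refl _) π f) : m ≤ numLayers π := by
  obtain ⟨P, hP⟩ := h
  rw [numLayers, hP.layers_eq, Set.ncard_coe_finset]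
  choose A hA hmem using fun i : Fin m => P.exists_mem (Finset.mem_univ (f i))
  have key : ∀ i j, i < j → A i ≠ A j := by
    intro i j hij e
    have h1 : π (f i) < π (f j) := (hf i j).1 hij
    have h2 := hP.anti (A j) (hA j) (e ▸ hmem i) (hmem j) (f.strictMono hij)
    exact lt_asymm h1 h2
  have hinj : Function.Injective A := by
    intro i j e
    rcases lt_trichotomy i j with hij | hij | hij
    · exact absurd e (key i j hij)
    · exact hij
    · exact absurd e.symm (key j i hij)
  simpa using Finset.card_le_card_of_injOn (s := Finset.univ) (t := P.parts) A
    (fun i _ => hA i) hinj.injOn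

theorem density_eq_zero {m n : ℕ} {σ : Equiv.Perm (Fin m)} {π : Equiv.Perm (Fin n)}
    (h : ∀ f, ¬ Induces σ π f) : density σ π = 0 := by
  have : IsEmpty {f : Fin m ↪o Fin n // Induces σ π f} := ⟨fun f => h f.1 f.2⟩
  simp [density]

theorem IsLayered.density_finRotate {n : ℕ} {π : Equiv.Perm (Fin n)} (h : IsLayered π) :
    density (finRotate 3) π = 0 := by
  refine density_eq_zero fun f hf => ?_
  have h1 := (hf 2 0).1 (by decide)
  have h2 := (hf 0 1).1 (by decide)
  have := h.lt_and_lt (f.strictMono (show (0 : Fin 3) < 1 by decide))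
    (f.strictMono (show (1 : Fin 3) < 2 by decide)) h1
  exact lt_asymm this.2 h2

theorem IsLayered.density_finRotate_symm {n : ℕ} {π : Equiv.Perm (Fin n)} (h : IsLayered π) :
    density (finRotate 3).symm π = 0 := by
  refine density_eq_zero fun f hf => ?_
  have h1 := (hf 2 0).1 (by decide)
  have h2 := (hf 1 2).1 (by decide)
  have := h.lt_and_lt (f.strictMono (show (0 : Fin 3) < 1 by decide))
    (f.strictMono (show (1 : Fin 3) < 2 by decide)) h1
  exact lt_asymm this.1 h2

end LayeredPerm

/-! ### Layers of permutons -/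

namespace Permuton

/-- A pattern formed by points of the support of a permuton has positive density. -/
theorem density_pos (P : Permuton) {m : ℕ} (σ : Equiv.Perm (Fin m))
    (p : Fin m → unitInterval × unitInterval) (hp : ∀ i, p i ∈ P.measure.support)
    (hx : ∀ i j, i < j → (p i).1 < (p j).1) (hy : ∀ i j, σ i < σ j → (p i).2 < (p j).2) :
    0 < density σ P := by
  have := P.isProbabilityMeasure
  set U : Set (Fin m → unitInterval × unitInterval) :=
    {q | (∀ i j, i < j → (q i).1 < (q j).1) ∧ ∀ i j, σ i < σ j → (q i).2 < (q j).2} with hU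
  have hopen : IsOpen U := by
    have : U = (⋂ i, ⋂ j, ⋂ _ : i < j, {q | (q i).1 < (q j).1}) ∩
        ⋂ i, ⋂ j, ⋂ _ : σ i < σ j, {q | (q i).2 < (q j).2} := by
      ext q
      simp [hU]
    rw [this]
    refine IsOpen.inter ?_ ?_ <;>
      refine isOpen_iInter_of_finite fun i => isOpen_iInter_of_finite fun j =>
        isOpen_iInter_of_finite fun _ => isOpen_lt ?_ ?_ <;> fun_prop
  have hsub : U ⊆ {p | Yields p σ} := by
    rintro q ⟨h1, h2⟩
    refine ⟨Equiv.refl _, fun i j hij => h1 i j hij, fun i j => ⟨h2 i j, fun hlt => ?_⟩⟩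
    by_contra! hle
    rcases eq_or_lt_of_le hle with e | hlt'
    · rw [σ.injective e] at hlt
      exact lt_irrefl _ hlt
    · exact lt_asymm hlt (h2 j i hlt')
  -- A box of neighbourhoods of the given points fits into the open set `U`, and its product measure
  -- is positive because these points are in the support.
  obtain ⟨V, hV, hVU⟩ := isOpen_pi_iff'.1 hopen p ⟨hx, hy⟩
  have hpos : 0 < Measure.pi (fun _ : Fin m => P.measure) (Set.univ.pi V) := by
    rw [Measure.pi_pi]
    exact CanonicallyOrderedAdd.prod_pos.2 fun i _ =>
      (Measure.mem_support_iff_forall _).1 (hp i) _ ((hV i).1.mem_nhds (hV i).2)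
  refine ENNReal.toReal_pos ?_ (measure_ne_top _ _)
  exact (hpos.trans_le (measure_mono (hVU.trans hsub))).ne'

theorem measure_fst_le (P : Permuton) (c : unitInterval) :
    P.measure.real {q | (q.1 : ℝ) ≤ c} = c := by
  have hset : {q : unitInterval × unitInterval | (q.1 : ℝ) ≤ c} = Set.Icc 0 c ×ˢ Set.univ := by
    ext q
    simp
  rw [Measure.real, hset, P.measure_fst 0 c c.2.1]
  simp [c.2.1]

theorem measure_snd_le (P : Permuton) (c : unitInterval) :
    P.measure.real {q | (q.2 : ℝ) ≤ c} = c := by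
  have hset : {q : unitInterval × unitInterval | (q.2 : ℝ) ≤ c} = Set.univ ×ˢ Set.Icc 0 c := by
    ext q
    simp
  rw [Measure.real, hset, P.measure_snd 0 c c.2.1]
  simp [c.2.1]

theorem measure_fst_eq (P : Permuton) (c : unitInterval) :
    P.measure {q | (q.1 : ℝ) = c} = 0 := by
  have hset : {q : unitInterval × unitInterval | (q.1 : ℝ) = c} = Set.Icc c c ×ˢ Set.univ := by
    ext q
    simp [Subtype.ext_iff]
  rw [hset, P.measure_fst c c le_rfl]
  simp

theorem measure_snd_eq (P : Permuton) (c : unitInterval) :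
    P.measure {q | (q.2 : ℝ) = c} = 0 := by
  have hset : {q : unitInterval × unitInterval | (q.2 : ℝ) = c} = Set.univ ×ˢ Set.Icc c c := by
    ext q
    simp [Subtype.ext_iff]
  rw [hset, P.measure_snd c c le_rfl]
  simp

theorem measure_fst_lt (P : Permuton) (c : unitInterval) :
    P.measure.real {q | (q.1 : ℝ) < c} = c := by
  have hset : {q : unitInterval × unitInterval | (q.1 : ℝ) < c} =
      {q | (q.1 : ℝ) ≤ c} \ {q | (q.1 : ℝ) = c} := by
    ext q
    exact lt_iff_le_and_ne (a := (q.1 : ℝ)) (b := c)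
  rw [Measure.real, hset, measure_sdiff_null (P.measure_fst_eq c)]
  exact P.measure_fst_le c

theorem measure_snd_lt (P : Permuton) (c : unitInterval) :
    P.measure.real {q | (q.2 : ℝ) < c} = c := by
  have hset : {q : unitInterval × unitInterval | (q.2 : ℝ) < c} =
      {q | (q.2 : ℝ) ≤ c} \ {q | (q.2 : ℝ) = c} := by
    ext q
    exact lt_iff_le_and_ne (a := (q.2 : ℝ)) (b := c)
  rw [Measure.real, hset, measure_sdiff_null (P.measure_snd_eq c)]
  exact P.measure_snd_le c

/-- Every vertical line meets the support of a permuton. -/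
theorem exists_mem_support (P : Permuton) (x : unitInterval) :
    ∃ y, (x, y) ∈ P.measure.support := by
  have := P.isProbabilityMeasure
  have hcl : IsClosed (Prod.fst '' P.measure.support) :=
    (Measure.isClosed_support.isCompact.image continuous_fst).isClosed
  suffices h : Prod.fst '' P.measure.support = Set.univ by
    obtain ⟨⟨x', y⟩, hq, rfl⟩ := h.symm ▸ Set.mem_univ x
    exact ⟨y, hq⟩
  -- The projection of the support is closed, so density suffices: the open strip over any interval
  -- has positive mass.
  rw [← hcl.closure_eq, ← dense_iff_closure_eq]
  refine dense_of_exists_between fun a b hab => ?_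
  have hpos : 0 < P.measure (Set.Icc a b ×ˢ Set.univ \
      ({q | (q.1 : ℝ) = a} ∪ {q | (q.1 : ℝ) = b})) := by
    rw [measure_sdiff_null (measure_union_null (P.measure_fst_eq a) (P.measure_fst_eq b)),
      P.measure_fst a b hab.le]
    simpa using hab
  obtain ⟨q, ⟨hq1, hq2⟩, hq3⟩ := Measure.nonempty_inter_support_of_pos hpos
  refine ⟨q.1, ⟨q, hq3, rfl⟩, lt_of_le_of_ne hq1.1.1 fun e => hq2 (Or.inl ?_),
    lt_of_le_of_ne hq1.1.2 fun e => hq2 (Or.inr ?_)⟩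
  · exact congrArg _ e.symm
  · exact congrArg _ e

theorem uniformAvoiding (P : Permuton) (h231 : density (finRotate 3) P = 0)
    (h312 : density (finRotate 3).symm P = 0) :
    UniformAvoiding P.measure (fun q => (q.1 : ℝ)) (fun q => (q.2 : ℝ)) where
  cont_fst := continuous_subtype_val.comp continuous_fst
  cont_snd := continuous_subtype_val.comp continuous_snd
  mem_fst q := q.1.2
  mem_snd q := q.2.2
  real_fst_lt c hc := P.measure_fst_lt ⟨c, hc⟩
  real_fst_le c hc := P.measure_fst_le ⟨c, hc⟩
  real_snd_lt c hc := P.measure_snd_lt ⟨c, hc⟩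
  real_snd_le c hc := P.measure_snd_le ⟨c, hc⟩
  not_231 p hp q hq r hr h1 h2 h3 h4 := by
    refine (P.density_pos (finRotate 3) ![p, q, r] ?_ ?_ ?_).ne' h231
    · intro i
      fin_cases i <;> assumption
    · have h5 := lt_trans h1 h2
      intro i j
      fin_cases i <;> fin_cases j <;> simp <;> assumption
    · have h5 := lt_trans h4 h3
      intro i j hij
      fin_cases i <;> fin_cases j <;>
        first | exact absurd hij (by decide) | exact h3 | exact h4 | exact h5
  not_312 p hp q hq r hr h1 h2 h3 h4 := by
    refine (P.density_pos (finRotate 3).symm ![p, q, r] ?_ ?_ ?_).ne' h312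
    · intro i
      fin_cases i <;> assumption
    · have h5 := lt_trans h1 h2
      intro i j
      fin_cases i <;> fin_cases j <;> simp <;> assumption
    · have h5 := lt_trans h3 h4
      intro i j hij
      fin_cases i <;> fin_cases j <;>
        first | exact absurd hij (by decide) | exact h3 | exact h4 | exact h5

/-- A permuton without the patterns `231` and `312` is layered. -/
theorem isLayered_of_density_eq_zero (P : Permuton) (h231 : density (finRotate 3) P = 0)
    (h312 : density (finRotate 3).symm P = 0) : P.IsLayered := by
  have := P.isProbabilityMeasure
  have h := P.uniformAvoiding h231 h312
  set f : unitInterval × unitInterval → ℝ := fun q => (q.1 : ℝ)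
  set g : unitInterval × unitInterval → ℝ := fun q => (q.2 : ℝ)
  let a : unitInterval × unitInterval → unitInterval := fun p =>
    ⟨UniformAvoiding.lower P.measure f g p,
      UniformAvoiding.lower_nonneg p, UniformAvoiding.lower_le_one p⟩
  let b : unitInterval × unitInterval → unitInterval := fun p =>
    ⟨UniformAvoiding.upper P.measure f g p,
      UniformAvoiding.upper_nonneg p, UniformAvoiding.upper_le_one p⟩
  have hax : ∀ p, a p ≤ p.1 := fun p => h.lower_le_fst p
  have hxb : ∀ p, p.1 ≤ b p := fun p => h.fst_le_upper p
  have hsum : ∀ p, (a p : ℝ) + b p = p.1 + p.2 := fun p => h.lower_add_upper p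
  have hdisj : ∀ p ∈ P.measure.support, ∀ q ∈ P.measure.support,
      (a p = a q ∧ b p = b q) ∨ b p ≤ a q ∨ b q ≤ a p := by
    intro p hp q hq
    simpa only [Subtype.ext_iff, ← Subtype.coe_le_coe] using h.layer_eq_or_disjoint hp hq
  let I : unitInterval × unitInterval → NonemptyInterval unitInterval := fun p =>
    ⟨(a p, b p), (hax p).trans (hxb p)⟩
  refine ⟨I '' P.measure.support, ?_, ?_⟩
  · rintro _ ⟨p, hp, rfl⟩ _ ⟨q, hq, rfl⟩ hne
    refine (hdisj p hp q hq).resolve_left fun e => hne ?_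
    ext
    · exact congrArg _ e.1
    · exact congrArg _ e.2
  intro x y
  constructor
  · intro hp
    refine ⟨I (x, y), ⟨_, hp, rfl⟩, ⟨hax (x, y), hxb (x, y)⟩, ?_⟩
    have := hsum (x, y)
    change (y : ℝ) = b (x, y) - (x - a (x, y))
    simp only at this
    linarith
  rintro ⟨_, ⟨p, hp, rfl⟩, ⟨hx1, hx2⟩, hy⟩
  change a p ≤ x at hx1
  change x ≤ b p at hx2
  change (y : ℝ) = b p - (x - a p) at hy
  rcases eq_or_lt_of_le ((hax p).trans (hxb p)) with hab | hab
  -- A layer of length zero consists of `p` alone.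
  · have hp1 : p.1 = x := le_antisymm ((hxb p).trans (hab ▸ hx1)) (hx2.trans (hab ▸ hax p))
    have hp2 : p.2 = y := by
      have := hsum p
      rw [hp1] at this
      ext
      linarith
    rwa [← hp1, ← hp2]
  -- A support point strictly over the layer of `p` cannot have an internally disjoint layer, so it
  -- has the same one.
  have hinner : ∀ x' ∈ Set.Ioo (a p) (b p), ∀ y', (x', y') ∈ P.measure.support →
      (y' : ℝ) = b p - (x' - a p) := by
    intro x' hx' y' hq
    rcases hdisj p hp _ hq with ⟨e1, e2⟩ | e | e
    · have := hsum (x', y')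
      rw [e1, e2]
      simp only at this
      linarith
    · exact absurd (hx'.2.trans_le (e.trans (hax (x', y')))) (lt_irrefl _)
    · exact absurd (((hxb (x', y')).trans e).trans_lt hx'.1) (lt_irrefl _)
  have hxcl : x ∈ closure (Set.Ioo (a p) (b p)) := by
    rw [closure_Ioo hab.ne]
    exact ⟨hx1, hx2⟩
  -- A continuous parametrization of the antidiagonal; `Set.projIcc` only makes it total and has no
  -- effect on the layer.
  let φ : ℝ → unitInterval × unitInterval := fun t =>
    (Set.projIcc 0 1 zero_le_one t, Set.projIcc 0 1 zero_le_one (b p - (t - a p)))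
  have hφ : Continuous fun t : unitInterval => φ t := by
    fun_prop
  have hφx : ∀ x' y' : unitInterval, (y' : ℝ) = b p - (x' - a p) → φ x' = (x', y') := by
    intro x' y' hy'
    simp [φ, ← hy']
  have hsub : Set.Ioo (a p) (b p) ⊆ (fun t : unitInterval => φ t) ⁻¹' P.measure.support := by
    intro x' hx'
    obtain ⟨y', hq⟩ := P.exists_mem_support x'
    change φ x' ∈ P.measure.support
    rwa [hφx x' y' (hinner x' hx' y' hq)]
  rw [← hφx x y hy]
  exact (Measure.isClosed_support.preimage hφ).closure_subset_iff.2 hsub hxcl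

/-- A layered permuton without an increasing pattern of order `k + 1` has at most `k` layers: the
midpoints of distinct layers lie in the support and form an increasing sequence. -/
theorem numLayers_le_of_density_eq_zero (P : Permuton) (h : P.IsLayered) (k : ℕ)
    (hk : density (Equiv.refl (Fin (k + 1))) P = 0) : P.numLayers ≤ k := by
  obtain ⟨J, hJ⟩ := h
  rw [numLayers, hJ.layers_eq]
  by_contra! hlt
  have hlt' : ((k + 1 : ℕ) : Cardinal) ≤ Cardinal.mk J := by
    rw [Nat.cast_succ, ← Cardinal.succ_natCast]
    exact Order.succ_le_of_lt hlt
  obtain ⟨s, hs⟩ := Cardinal.exists_finset_eq_card hlt'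
  -- The antidiagonal of a layer meets the main diagonal at its midpoint, and points of the main
  -- diagonal form an increasing pattern.
  let c : J → unitInterval := fun A =>
    ⟨((A.1.fst : ℝ) + A.1.snd) / 2, by
      constructor <;> linarith [A.1.fst.2.1, A.1.fst.2.2, A.1.snd.2.1, A.1.snd.2.2]⟩
  have hc : Function.Injective c := by
    intro A B hAB
    have hmid : ((A.1.fst : ℝ) + A.1.snd) / 2 = (B.1.fst + B.1.snd) / 2 := congrArg Subtype.val hAB
    by_contra hne
    have h1 : (A.1.fst : ℝ) ≤ A.1.snd := A.1.fst_le_snd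
    have h2 : (B.1.fst : ℝ) ≤ B.1.snd := B.1.fst_le_snd
    have hne' : A.1 ≠ B.1 := fun e => hne (Subtype.ext e)
    have h3 : (A.1.snd : ℝ) ≤ B.1.fst ∨ (B.1.snd : ℝ) ≤ A.1.fst :=
      hJ.internally_disjoint A.1 A.2 B.1 B.2 hne'
    apply hne'
    ext
    · rcases h3 with h | h <;> linarith
    · rcases h3 with h | h <;> linarith
  have hcs : (s.image c).card = k + 1 := by
    rw [Finset.card_image_of_injective _ hc, hs]
  let e := (s.image c).orderEmbOfFin hcs
  refine (P.density_pos (Equiv.refl _) (fun i => (e i, e i)) (fun i => ?_)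
    (fun i j hij => e.strictMono hij) (fun i j hij => e.strictMono hij)).ne' hk
  obtain ⟨A, -, hA⟩ := Finset.mem_image.1 ((s.image c).orderEmbOfFin_mem hcs i)
  have hA' : (e i : ℝ) = ((A.1.fst : ℝ) + A.1.snd) / 2 := congrArg Subtype.val hA.symm
  have h1 : (A.1.fst : ℝ) ≤ A.1.snd := A.1.fst_le_snd
  refine (hJ.mem_support _ _).2 ⟨A.1, A.2, ⟨?_, ?_⟩, ?_⟩
  · rw [← Subtype.coe_le_coe]
    linarith
  · rw [← Subtype.coe_le_coe]
    linarith
  · linarith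

end Permuton

/-! ### Passage to the limit -/

theorem mainTheorem5 (N : ℕ → ℕ) (π : ∀ n : ℕ, Equiv.Perm (Fin (N n)))
    (hconv : PermConvergent N π) (P : Permuton) (hlim : P.IsLimit N π)
    (hlay : ∀ n : ℕ, LayeredPerm.IsLayered (π n)) :
    P.IsLayered ∧
      ∀ k : ℕ, (∀ n : ℕ, LayeredPerm.numLayers (π n) ≤ k) → P.numLayers ≤ (k : Cardinal) := by
  have hzero : ∀ {m : ℕ} (σ : Equiv.Perm (Fin m)), (∀ n, LayeredPerm.density σ (π n) = 0) →
      P.density σ = 0 := by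
    intro m σ hσ
    refine tendsto_nhds_unique (hlim m σ) ?_
    simp only [hσ]
    exact tendsto_const_nhds
  have hP : P.IsLayered := P.isLayered_of_density_eq_zero
    (hzero _ fun n => (hlay n).density_finRotate) (hzero _ fun n => (hlay n).density_finRotate_symm)
  refine ⟨hP, fun k hk => P.numLayers_le_of_density_eq_zero hP k (hzero _ fun n => ?_)⟩
  exact LayeredPerm.density_eq_zero fun f hf =>
    absurd ((hlay n).le_numLayers hf) (by have := hk n; omega)
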